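/- Let $k$ be a field and $A$ a finite-dimensional $k$-algebra. Modules are left modules, $\mathrm{mod}\,A$ is the category of finitely generated $A$-modules, and $D=\mathrm{Hom}_k(-,k)$. A module $G\in\mathrm{mod}\,A$ is Gorenstein-projective if $G\cong\ker d^0$ for an exact complex $\cdots\to P^{-1}\to P^0\xrightarrow{d^0}P^1\to\cdots$ of finitely generated projective $A$-modules that stays exact under $\mathrm{Hom}_A(-,Q)$ for every finitely generated projective $Q$. Let $\mathrm{Gproj}\,A\subseteq\mathrm{mod}\,A$ be the class of these modules. Assume that $A$ is of finite CM-type: up to isomorphism there are only finitely many indecomposable modules in $\mathrm{Gproj}\,A$. Let $E_1,\dots,E_n$ be a complete list of them without repetition, put $E=\bigoplus_{i=1}^n E_i$, and let $A(\mathrm{Gproj})=\mathrm{End}_A(E)^{op}$ be the Cohen–Macaulay Auslander algebra of $A$. * A proper Gorenstein-projective presentation of $M\in\mathrm{mod}\,A$ is an exact sequence $G_1\xrightarrow{\theta}G_0\xrightarrow{\pi}M\to0$ with $G_0,G_1\in\mathrm{Gproj}\,A$ that stays exact under $\mathrm{Hom}_A(G,-)$ for every $G\in\mathrm{Gproj}\,A$.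 It is minimal if $\pi$ and $G_1\to\mathrm{Im}\,\theta$ are right minimal (a morphism $g$ is right minimal if every endomorphism $e$ of its source with $ge=g$ is an automorphism). * For a minimal such presentation, let $\tau_GM$ be the kernel of the map $D\mathrm{Hom}_A(G_1,E)\to D\mathrm{Hom}_A(G_0,E)$ of left $A(\mathrm{Gproj})$-modules induced by $\theta$. The module $M$ is $\tau_G$-rigid if $\mathrm{Hom}_{A(\mathrm{Gproj})}(\mathrm{Hom}_A(E,M),\tau_GM)=0$. The algebra $A$ is $\tau_G$-tilting finite if there are only finitely many isomorphism classes of indecomposable $\tau_G$-rigid modules in $\mathrm{mod}\,A$. * For a finite-dimensional algebra $B$, a module $N\in\mathrm{mod}\,B$ is $\tau$-rigid if $\mathrm{Hom}_B(N,\tau N)=0$, where $\tau$ is the Auslander–Reiten translation, and $B$ is $\tau$-tilting finite if there are only finitely many isomorphism classes of indecomposable $\tau$-rigid modules in $\mathrm{mod}\,B$. * A $G$-epimorphism is an epimorphism $g$ of $A$-modules such that $\mathrm{Hom}_A(G,g)$ is surjective for all $G\in\mathrm{Gproj}\,A$; a short exact sequence $0\to X\to Y\xrightarrow{g}Z\to0$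 is $G$-exact if $g$ is a $G$-epimorphism. A module $T\in\mathrm{mod}\,A$ is partial Gorenstein silting if it has a proper Gorenstein-projective presentation $\theta:G_1\to G_0$ such that the class $D_\theta$ of all $A$-modules $X$ (not necessarily finitely generated) for which $\mathrm{Hom}_A(\theta,X)$ is surjective contains $T$ and is closed under targets of $G$-epimorphisms, extensions by $G$-exact sequences, and arbitrary coproducts. If $A(\mathrm{Gproj})$ is $\tau$-tilting finite, then $A$ is $\tau_G$-tilting finite, and moreover there are only finitely many isomorphism classes of indecomposable partial Gorenstein silting modules in $\mathrm{mod}\,A$. -/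

import Mathlib

universe u v

open CategoryTheory

noncomputable section

/-! ### Isomorphism classes and approximations -/

/-- The modules with property `P` form only finitely many isomorphism classes. -/
def FiniteIsoClasses {R : Type u} [Ring R] (P : ModuleCat.{u} R → Prop) : Prop :=
  {c : Quotient (isIsomorphicSetoid (ModuleCat.{u} R)) |
    ∃ M : ModuleCat.{u} R, P M ∧ Quotient.mk _ M = c}.Finite

/-- A morphism `g : X ⟶ M` is right minimal if every endomorphism `e` of `X` with `g ∘ e = g` is
an automorphism. -/
def IsRightMinimal {R X M : Type*} [Ring R] [AddCommGroup X] [Module R X]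
    [AddCommGroup M] [Module R M] (g : X →ₗ[R] M) : Prop :=
  ∀ e : X →ₗ[R] X, g ∘ₗ e = g → Function.Bijective e

/-! ### Gorenstein-projective modules -/

/-- A finitely generated module `G` is Gorenstein-projective if it is isomorphic to `Ker d⁰` for
an exact complex `⋯ ⟶ P⁻¹ ⟶ P⁰ ⟶ P¹ ⟶ ⋯` of finitely generated projective modules which stays
exact under `Hom(-, Q)` for every finitely generated projective module `Q`. -/
def IsGproj (A : Type u) [Ring A] (G : Type u) [AddCommGroup G] [Module A G] : Prop :=
  ∃ (P : ℤ → ModuleCat.{u} A) (d : ∀ i : ℤ, P i →ₗ[A] P (i + 1)),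
    (∀ i, Module.Finite A (P i) ∧ Module.Projective A (P i)) ∧
    (∀ i, Function.Exact (d i) (d (i + 1))) ∧
    (∀ (Q : Type u) [AddCommGroup Q] [Module A Q], Module.Finite A Q → Module.Projective A Q →
      ∀ i, Function.Exact
        (fun h : P (i + 1 + 1) →ₗ[A] Q => h ∘ₗ d (i + 1))
        (fun h : P (i + 1) →ₗ[A] Q => h ∘ₗ d i)) ∧
    Nonempty (G ≃ₗ[A] LinearMap.ker (d 0))

/-- `G₁ ⟶ G₀ ⟶ M ⟶ 0` (with maps `θ` and `π`) is a proper Gorenstein-projective presentation of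
`M`: it is exact, `G₁` and `G₀` are finitely generated Gorenstein-projective, and it stays exact
under `Hom(G, -)` for every finitely generated Gorenstein-projective module `G`. -/
structure IsProperGprojPresentation {A : Type u} [Ring A] {G₁ G₀ M : Type u}
    [AddCommGroup G₁] [Module A G₁] [AddCommGroup G₀] [Module A G₀] [AddCommGroup M] [Module A M]
    (θ : G₁ →ₗ[A] G₀) (π : G₀ →ₗ[A] M) : Prop where
  finite₁ : Module.Finite A G₁
  finite₀ : Module.Finite A G₀
  gproj₁ : IsGproj A G₁
  gproj₀ : IsGproj A G₀
  exact : Function.Exact θ π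
  surjective : Function.Surjective π
  hom_exact : ∀ (G : Type u) [AddCommGroup G] [Module A G], Module.Finite A G → IsGproj A G →
    Function.Exact (fun h : G →ₗ[A] G₁ => θ ∘ₗ h) (fun h : G →ₗ[A] G₀ => π ∘ₗ h)
  hom_surjective : ∀ (G : Type u) [AddCommGroup G] [Module A G], Module.Finite A G →
    IsGproj A G → Function.Surjective (fun h : G →ₗ[A] G₀ => π ∘ₗ h)

/-- A proper Gorenstein-projective presentation is minimal if `G₀ ⟶ M` and `G₁ ⟶ Im θ` are
minimal right approximations by finitely generated Gorenstein-projective modules.  (That they are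
right approximations is properness.) -/
structure IsMinimalGprojPresentation {A : Type u} [Ring A] {G₁ G₀ M : Type u}
    [AddCommGroup G₁] [Module A G₁] [AddCommGroup G₀] [Module A G₀] [AddCommGroup M] [Module A M]
    (θ : G₁ →ₗ[A] G₀) (π : G₀ →ₗ[A] M) : Prop extends IsProperGprojPresentation θ π where
  minimal₁ : IsRightMinimal θ.rangeRestrict
  minimal₀ : IsRightMinimal π

/-- `E` is a complete irredundant list of the indecomposable finitely generated
Gorenstein-projective `A`-modules up to isomorphism. -/
structure IsGprojList (A : Type u) [Ring A] {n : ℕ} (E : Fin n → Type u)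
    [∀ i, AddCommGroup (E i)] [∀ i, Module A (E i)] : Prop where
  finite : ∀ i, Module.Finite A (E i)
  gproj : ∀ i, IsGproj A (E i)
  indecomposable : ∀ i, Indecomposable (ModuleCat.of A (E i))
  not_iso : ∀ i j, Nonempty (E i ≃ₗ[A] E j) → i = j
  complete : ∀ (G : Type u) [AddCommGroup G] [Module A G], Module.Finite A G → IsGproj A G →
    Indecomposable (ModuleCat.of A G) → ∃ i, Nonempty (G ≃ₗ[A] E i)

/-! ### τ-rigid modules over an algebra -/

section Tau

variable (k : Type v) [Field k] (B : Type u) [Ring B] [Algebra k B]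

/-- `D Hom_B(P, B)`, where `D` is the `k`-dual. -/
def NakayamaDual (P : Type u) [AddCommGroup P] [Module B P] : Type (max u v) :=
  Module.Dual k (P →ₗ[B] B)

variable {k B} in
/-- The underlying `k`-linear functional. -/
def NakayamaDual.toDual {P : Type u} [AddCommGroup P] [Module B P] (φ : NakayamaDual k B P) :
    Module.Dual k (P →ₗ[B] B) := φ

instance (P : Type u) [AddCommGroup P] [Module B P] : AddCommGroup (NakayamaDual k B P) :=
  inferInstanceAs (AddCommGroup (Module.Dual k (P →ₗ[B] B)))

/-- The left `B`-module structure on `D Hom_B(P, B)`, which is dual to the right `B`-module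
structure `(h b)(p) = h(p) b` on `Hom_B(P, B)`. -/
instance (P : Type u) [AddCommGroup P] [Module B P] : Module B (NakayamaDual k B P) where
  smul b φ :=
    ({ toFun := fun h => φ.toDual (MulOpposite.op b • h)
       map_add' := fun h h' => by rw [smul_add, map_add]
       map_smul' := fun c h => by rw [smul_comm, map_smul]; rfl } : Module.Dual k (P →ₗ[B] B))
  one_smul φ := LinearMap.ext fun h =>
    congrArg φ.toDual (one_smul Bᵐᵒᵖ h)
  mul_smul b b' φ := LinearMap.ext fun h =>
    congrArg φ.toDual
      (mul_smul (MulOpposite.op b') (MulOpposite.op b) h)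
  smul_zero _ := rfl
  smul_add _ _ _ := rfl
  add_smul b b' φ := LinearMap.ext fun h =>
    (congrArg φ.toDual
      (add_smul (MulOpposite.op b) (MulOpposite.op b') h)).trans (map_add _ _ _)
  zero_smul φ := LinearMap.ext fun h =>
    (congrArg φ.toDual (zero_smul Bᵐᵒᵖ h)).trans (map_zero _)

variable {B} in
/-- The map `D Hom_B(P₁, B) ⟶ D Hom_B(P₀, B)` induced by `f : P₁ ⟶ P₀`. -/
def nakayamaMap {P₁ P₀ : Type u} [AddCommGroup P₁] [Module B P₁] [AddCommGroup P₀] [Module B P₀]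
    (f : P₁ →ₗ[B] P₀) : NakayamaDual k B P₁ →ₗ[B] NakayamaDual k B P₀ where
  toFun φ := φ.toDual ∘ₗ (LinearMap.lcomp k B f)
  map_add' _ _ := rfl
  map_smul' _ _ := rfl

variable {B} in
/-- The kernel of `D Hom_B(P₁, B) ⟶ D Hom_B(P₀, B)`; this is the Auslander–Reiten translate `τ N`
when `f : P₁ ⟶ P₀` belongs to a minimal projective presentation of `N`. -/
def tauOfPresentation {P₁ P₀ : Type u} [AddCommGroup P₁] [Module B P₁] [AddCommGroup P₀]
    [Module B P₀] (f : P₁ →ₗ[B] P₀) : Submodule B (NakayamaDual k B P₁) :=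
  LinearMap.ker (nakayamaMap k f)

variable {B} in
/-- `P₁ ⟶ P₀ ⟶ N ⟶ 0` is a minimal projective presentation of `N` by finitely generated
projective modules. -/
structure IsMinimalProjPresentation {P₁ P₀ N : Type u} [AddCommGroup P₁] [Module B P₁]
    [AddCommGroup P₀] [Module B P₀] [AddCommGroup N] [Module B N]
    (f : P₁ →ₗ[B] P₀) (p : P₀ →ₗ[B] N) : Prop where
  finite₁ : Module.Finite B P₁
  finite₀ : Module.Finite B P₀
  projective₁ : Module.Projective B P₁
  projective₀ : Module.Projective B P₀
  exact : Function.Exact f p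
  surjective : Function.Surjective p
  minimal₁ : IsRightMinimal f.rangeRestrict
  minimal₀ : IsRightMinimal p

/-- The module `N` is τ-rigid: `Hom_B(N, τ N) = 0`. -/
def IsTauRigid (N : Type u) [AddCommGroup N] [Module B N] : Prop :=
  ∃ (P₁ P₀ : ModuleCat.{u} B) (f : P₁ →ₗ[B] P₀) (p : P₀ →ₗ[B] N),
    IsMinimalProjPresentation f p ∧ ∀ g : N →ₗ[B] tauOfPresentation k f, g = 0

/-- The algebra `B` is τ-tilting finite: it has only finitely many isomorphism classes of
indecomposable (finitely generated) τ-rigid modules. -/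
def TauTiltingFinite : Prop :=
  FiniteIsoClasses fun N : ModuleCat.{u} B =>
    Module.Finite B N ∧ Indecomposable N ∧ IsTauRigid k B N

end Tau

/-! ### The endomorphism algebra of `E` and `τ_G`-rigid modules -/

section TauG

variable (k : Type v) [Field k] (A : Type u) [Ring A] [Algebra k A]

/-- The algebra `End_A(E)ᵒᵖ`.  It is the Cohen–Macaulay Auslander algebra of `A` when `E` is the
direct sum of a complete list of indecomposable Gorenstein-projectives. -/
abbrev EndOp (E : Type u) [AddCommGroup E] [Module A E] : Type u := (Module.End A E)ᵐᵒᵖ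

/-- `Hom_A(E, M)`, regarded as a left module over `End_A(E)ᵒᵖ`. -/
def HomFrom (E M : Type u) [AddCommGroup E] [Module A E] [AddCommGroup M] [Module A M] : Type u :=
  E →ₗ[A] M

variable {A} in
/-- The underlying `A`-linear map. -/
def HomFrom.toHom {E M : Type u} [AddCommGroup E] [Module A E] [AddCommGroup M] [Module A M]
    (h : HomFrom A E M) : E →ₗ[A] M := h

instance (E M : Type u) [AddCommGroup E] [Module A E] [AddCommGroup M] [Module A M] :
    AddCommGroup (HomFrom A E M) := inferInstanceAs (AddCommGroup (E →ₗ[A] M))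

/-- `End_A(E)ᵒᵖ` acts on `Hom_A(E, M)` by precomposition. -/
instance (E M : Type u) [AddCommGroup E] [Module A E] [AddCommGroup M] [Module A M] :
    Module (EndOp A E) (HomFrom A E M) where
  smul γ h := h.toHom ∘ₗ γ.unop
  one_smul _ := rfl
  mul_smul _ _ _ := rfl
  smul_zero _ := rfl
  smul_add _ _ _ := rfl
  add_smul γ γ' h := LinearMap.comp_add γ.unop γ'.unop h.toHom
  zero_smul h := LinearMap.comp_zero h.toHom

section DualHom

variable (E : Type u) [AddCommGroup E] [Module A E] [Module k E] [IsScalarTower k A E]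

/-- `D Hom_A(G, E)`, where `D` is the `k`-dual. -/
def DualHom (G : Type u) [AddCommGroup G] [Module A G] : Type (max u v) :=
  Module.Dual k (G →ₗ[A] E)

variable {k A E} in
/-- The underlying `k`-linear functional. -/
def DualHom.toDual {G : Type u} [AddCommGroup G] [Module A G] (φ : DualHom k A E G) :
    Module.Dual k (G →ₗ[A] E) := φ

instance (G : Type u) [AddCommGroup G] [Module A G] : AddCommGroup (DualHom k A E G) :=
  inferInstanceAs (AddCommGroup (Module.Dual k (G →ₗ[A] E)))

/-- The left `End_A(E)ᵒᵖ`-module structure on `D Hom_A(G, E)`, which is dual to the left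
`End_A(E)`-module structure on `Hom_A(G, E)` by postcomposition. -/
instance (G : Type u) [AddCommGroup G] [Module A G] :
    Module (EndOp A E) (DualHom k A E G) where
  smul γ φ :=
    ({ toFun := fun h => φ.toDual (γ.unop ∘ₗ h)
       map_add' := fun h h' => by rw [LinearMap.comp_add, map_add]
       map_smul' := fun c h => by
        have : γ.unop ∘ₗ (c • h) = c • (γ.unop ∘ₗ h) := by
          ext x
          simp [LinearMap.map_smul_of_tower]
        rw [this, map_smul]; rfl } : Module.Dual k (G →ₗ[A] E))
  one_smul _ := rfl
  mul_smul _ _ _ := rfl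
  smul_zero _ := rfl
  smul_add _ _ _ := rfl
  add_smul γ γ' φ := LinearMap.ext fun h =>
    (congrArg φ.toDual
      (LinearMap.add_comp h γ'.unop γ.unop)).trans (map_add _ _ _)
  zero_smul φ := LinearMap.ext fun h =>
    (congrArg φ.toDual (LinearMap.zero_comp h)).trans (map_zero _)

variable {A} in
/-- The map `D Hom_A(G₁, E) ⟶ D Hom_A(G₀, E)` induced by `θ : G₁ ⟶ G₀`. -/
def dualHomMap {G₁ G₀ : Type u} [AddCommGroup G₁] [Module A G₁] [AddCommGroup G₀] [Module A G₀]
    (θ : G₁ →ₗ[A] G₀) : DualHom k A E G₁ →ₗ[EndOp A E] DualHom k A E G₀ where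
  toFun φ := φ.toDual ∘ₗ (LinearMap.lcomp k E θ)
  map_add' _ _ := rfl
  map_smul' _ _ := rfl

variable {A} in
/-- The kernel of `D Hom_A(G₁, E) ⟶ D Hom_A(G₀, E)`; this is `τ_G M` when `θ : G₁ ⟶ G₀` belongs
to a minimal Gorenstein-projective presentation of `M`. -/
def tauGOfPresentation {G₁ G₀ : Type u} [AddCommGroup G₁] [Module A G₁] [AddCommGroup G₀]
    [Module A G₀] (θ : G₁ →ₗ[A] G₀) : Submodule (EndOp A E) (DualHom k A E G₁) :=
  LinearMap.ker (dualHomMap k E θ)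

/-- The module `M` is `τ_G`-rigid: `Hom(Hom_A(E, M), τ_G M) = 0` over `End_A(E)ᵒᵖ`. -/
def IsTauGRigid (M : Type u) [AddCommGroup M] [Module A M] : Prop :=
  ∃ (G₁ G₀ : ModuleCat.{u} A) (θ : G₁ →ₗ[A] G₀) (π : G₀ →ₗ[A] M),
    IsMinimalGprojPresentation θ π ∧
      ∀ g : HomFrom A E M →ₗ[EndOp A E] tauGOfPresentation k E θ, g = 0

/-- The algebra `A` is `τ_G`-tilting finite (`E` being the Gorenstein-projective generator): it
has only finitely many isomorphism classes of indecomposable (finitely generated) `τ_G`-rigid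
modules. -/
def TauGTiltingFinite : Prop :=
  FiniteIsoClasses fun M : ModuleCat.{u} A =>
    Module.Finite A M ∧ Indecomposable M ∧ IsTauGRigid k A E M

end DualHom

end TauG

/-! ### Partial Gorenstein silting modules -/

section Silting

variable {A : Type u} [Ring A]

/-- `X` belongs to `D_θ`: the map `Hom_A(θ, X)` is surjective. -/
def InD {G₁ G₀ : Type u} [AddCommGroup G₁] [Module A G₁] [AddCommGroup G₀] [Module A G₀]
    (θ : G₁ →ₗ[A] G₀) (X : Type u) [AddCommGroup X] [Module A X] : Prop :=
  Function.Surjective (fun h : G₀ →ₗ[A] X => h ∘ₗ θ)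

/-- `g` is a `G`-epimorphism: an epimorphism such that `Hom_A(G, g)` is surjective for every
finitely generated Gorenstein-projective module `G`. -/
def IsGEpi {Y Z : Type u} [AddCommGroup Y] [Module A Y] [AddCommGroup Z] [Module A Z]
    (g : Y →ₗ[A] Z) : Prop :=
  Function.Surjective g ∧
    ∀ (G : Type u) [AddCommGroup G] [Module A G], Module.Finite A G → IsGproj A G →
      Function.Surjective (fun h : G →ₗ[A] Y => g ∘ₗ h)

/-- `D_θ` is a relative torsion class: it is closed under `G`-epimorphic images, `G`-extensions
and coproducts, in the category of all `A`-modules. -/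
structure IsRelativeTorsionClass {G₁ G₀ : Type u} [AddCommGroup G₁] [Module A G₁]
    [AddCommGroup G₀] [Module A G₀] (θ : G₁ →ₗ[A] G₀) : Prop where
  image : ∀ (X Y : Type u) [AddCommGroup X] [Module A X] [AddCommGroup Y] [Module A Y]
    (g : X →ₗ[A] Y), IsGEpi g → InD θ X → InD θ Y
  extension : ∀ (X Y Z : Type u) [AddCommGroup X] [Module A X] [AddCommGroup Y] [Module A Y]
    [AddCommGroup Z] [Module A Z] (f : X →ₗ[A] Y) (g : Y →ₗ[A] Z),
    Function.Injective f → Function.Exact f g → IsGEpi g → InD θ X → InD θ Z → InD θ Y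
  coproduct : ∀ (ι : Type u) (X : ι → Type u) [∀ i, AddCommGroup (X i)] [∀ i, Module A (X i)],
    (∀ i, InD θ (X i)) → InD θ (DirectSum ι X)

variable (A) in
/-- The module `T` is partial Gorenstein silting: it has a proper Gorenstein-projective
presentation `θ` such that `D_θ` is a relative torsion class containing `T`. -/
def IsPartialGorensteinSilting (T : Type u) [AddCommGroup T] [Module A T] : Prop :=
  ∃ (G₁ G₀ : ModuleCat.{u} A) (θ : G₁ →ₗ[A] G₀) (π : G₀ →ₗ[A] T),
    IsProperGprojPresentation θ π ∧ IsRelativeTorsionClass θ ∧ InD θ T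

end Silting

end

noncomputable section

/-! ### Indecomposable modules and idempotents -/

/-! Write `E` for the sum of the list, `B = End_A(E)ᵒᵖ` and `F = Hom_A(E, -)`. The regular module
`A` is Gorenstein-projective, hence lies in `add E`, so `E` is a generator and `F` is fully faithful
on all `A`-modules. Thus `F` detects isomorphism and preserves indecomposability (seen through
idempotents), and it suffices that `F` sends both classes of modules to finitely generated τ-rigid
`B`-modules.

On `add E`, which contains every finitely generated Gorenstein-projective module, `F` takes finitely
generated projective values. So it turns a proper Gorenstein-projective presentation of `M` into a
projective presentation of `F M`, minimal if the first one was. The map `D Hom_B(F G, B) ⟶ D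
Hom_A(G, E)` is injective for `G` in `add E`, so `τ (F M)` embeds in `τ_G M`, and `τ_G`-rigidity of
`M` gives τ-rigidity of `F M`. In the silting case `T ∈ D_θ` says that every map `G₁ ⟶ T` factors
through `θ`; by fullness every map `F G₁ ⟶ F T` factors through `F θ`, and this forces τ-rigidity
even when the presentation is not minimal (`IsTauRigid.of_presentation`).

The inclusion of Gorenstein-projectives in `add E` (`IsGprojList.inAdd`) needs closure under direct
summands. For this a complete resolution is cut into short exact sequences, and each of them is
pushed to a summand (`IsProjExtension.retract_right`, `IsProjExtension.retract_left`). -/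

theorem indecomposable_iff_idempotents {R : Type u} [Ring R] (M : ModuleCat.{u} R) :
    Indecomposable M ↔ Nontrivial M ∧ ∀ e : M →ₗ[R] M, e ∘ₗ e = e → e = 0 ∨ e = LinearMap.id := by
  unfold Indecomposable
  rw [ModuleCat.isZero_iff_subsingleton, not_subsingleton_iff_nontrivial]
  refine and_congr_right fun _ => ⟨fun H e he => ?_, fun H Y Z i => ?_⟩
  -- An idempotent splits the module into its range and its kernel, so one of the two vanishes.
  · have hc : IsCompl (LinearMap.range e) (LinearMap.ker e) :=
      LinearMap.IsIdempotentElem.isCompl (f := e) he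
    have i := ((Submodule.prodEquivOfIsCompl _ _ hc).symm.toModuleIso : M ≅ _) ≪≫
      (ModuleCat.biprodIsoProd (ModuleCat.of R (LinearMap.range e))
        (ModuleCat.of R (LinearMap.ker e))).symm
    rcases H _ _ i with h | h
    · rw [ModuleCat.isZero_of_iff_subsingleton, Submodule.subsingleton_iff_eq_bot] at h
      exact Or.inl (LinearMap.range_eq_bot.1 h)
    · rw [ModuleCat.isZero_of_iff_subsingleton, Submodule.subsingleton_iff_eq_bot] at h
      refine Or.inr (LinearMap.ext fun x => LinearMap.ker_eq_bot.1 h ?_)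
      exact LinearMap.congr_fun he x
  · let φ : M ≃ₗ[R] Y × Z := (i ≪≫ ModuleCat.biprodIsoProd Y Z).toLinearEquiv
    let e : M →ₗ[R] M :=
      φ.symm.toLinearMap ∘ₗ (LinearMap.inl R Y Z ∘ₗ LinearMap.fst R Y Z) ∘ₗ φ.toLinearMap
    have he : ∀ x, e x = φ.symm ((φ x).1, 0) := fun x => rfl
    simp only [ModuleCat.isZero_iff_subsingleton]
    rcases H e (LinearMap.ext fun x => by simp [he]) with h | h
    · refine Or.inl (subsingleton_of_forall_eq 0 fun y => ?_)
      have := LinearMap.congr_fun h (φ.symm (y, 0))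
      rw [he] at this
      simpa using this
    · refine Or.inr (subsingleton_of_forall_eq 0 fun z => ?_)
      have := LinearMap.congr_fun h (φ.symm (0, z))
      rw [he] at this
      simpa using this.symm

/-! ### Gorenstein-projective modules by one-step approximations -/

section Gproj

variable {A : Type u} [Ring A]

/-- There is an exact sequence `0 ⟶ X ⟶ P ⟶ X' ⟶ 0` with `P` finitely generated projective that
stays exact under maps to finitely generated projective modules. -/
def IsProjExtension (X X' : ModuleCat.{u} A) : Prop :=
  ∃ (P : ModuleCat.{u} A) (f : X →ₗ[A] P) (g : P →ₗ[A] X'),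
    Module.Finite A P ∧ Module.Projective A P ∧
    Function.Injective f ∧ Function.Exact f g ∧ Function.Surjective g ∧
    ∀ (Q : Type u) [AddCommGroup Q] [Module A Q], Module.Finite A Q → Module.Projective A Q →
      ∀ h : X →ₗ[A] Q, ∃ h' : P →ₗ[A] Q, h' ∘ₗ f = h

/-- A class of modules each member of which is both the left and the right end of some
`IsProjExtension` whose other end is again in the class. -/
structure IsSyzygyClosed (W : ModuleCat.{u} A → Prop) : Prop where
  right : ∀ X, W X → ∃ X', W X' ∧ IsProjExtension X X'
  left : ∀ X, W X → ∃ X', W X' ∧ IsProjExtension X' X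

theorem IsSyzygyClosed.exists_int_seq {W : ModuleCat.{u} A → Prop} (hW : IsSyzygyClosed W)
    (X : ModuleCat.{u} A) (hX : W X) :
    ∃ s : ℤ → ModuleCat.{u} A, s 0 = X ∧ ∀ i, IsProjExtension (s i) (s (i + 1)) := by
  choose! r hrW hr using hW.right
  choose! l hlW hl using hW.left
  have hrn : ∀ n, W (r^[n] X) := fun n => by
    induction n with
    | zero => exact hX
    | succ n ih => rw [Function.iterate_succ_apply']; exact hrW _ ih
  have hln : ∀ n, W (l^[n] X) := fun n => by
    induction n with
    | zero => exact hX
    | succ n ih => rw [Function.iterate_succ_apply']; exact hlW _ ih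
  -- `Int.negSucc n` is `-(n + 1)`, hence the `n + 1` iterates; the case `negSucc 0` is the joint
  -- with `X` at index `0`.
  let s : ℤ → ModuleCat.{u} A
    | Int.ofNat n => r^[n] X
    | Int.negSucc n => l^[n + 1] X
  refine ⟨s, rfl, fun i => ?_⟩
  match i with
  | Int.ofNat n =>
    change IsProjExtension (r^[n] X) (r^[n + 1] X)
    rw [Function.iterate_succ_apply']
    exact hr _ (hrn n)
  | Int.negSucc 0 => exact hl _ hX
  | Int.negSucc (n + 1) =>
    change IsProjExtension (l^[n + 1 + 1] X) (l^[n + 1] X)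
    rw [Function.iterate_succ_apply']
    exact hl _ (hln (n + 1))

/-- Splice the short exact sequences: the differential is `P i ⟶ s (i + 1) ⟶ P (i + 1)`, with kernel
the image of `s i`. -/
theorem IsSyzygyClosed.isGproj {W : ModuleCat.{u} A → Prop} (hW : IsSyzygyClosed W)
    (X : ModuleCat.{u} A) (hX : W X) : IsGproj A X := by
  obtain ⟨s, rfl, hs⟩ := hW.exists_int_seq X hX
  choose P f g hfin hproj hinj hex hsurj hext using hs
  have hcomp : ∀ i x, g i (f i x) = 0 := fun i x => (hex i).apply_apply_eq_zero x
  refine ⟨P, fun i => f (i + 1) ∘ₗ g i, fun i => ⟨hfin i, hproj i⟩, fun i y => ?_,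
    fun Q _ _ hQ hQ' i h => ?_, ?_⟩
  · constructor
    · intro h
      have h0 : g (i + 1) y = 0 := hinj (i + 1 + 1) (by simpa using h)
      obtain ⟨x, rfl⟩ := (hex (i + 1) y).1 h0
      obtain ⟨z, rfl⟩ := hsurj i x
      exact ⟨z, rfl⟩
    · rintro ⟨z, rfl⟩
      simp [hcomp]
  · constructor
    · intro h0
      -- `h` descends along `g (i + 1)` to `s (i + 1 + 1)`; the descended map `h1` then extends over
      -- the next projective.
      have hk : LinearMap.ker (g (i + 1)) ≤ LinearMap.ker h := by
        intro y hy
        obtain ⟨x, rfl⟩ := (hex (i + 1) y).1 hy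
        obtain ⟨z, rfl⟩ := hsurj i x
        exact LinearMap.congr_fun h0 z
      let h1 : s (i + 1 + 1) →ₗ[A] Q := (LinearMap.ker (g (i + 1))).liftQ h hk ∘ₗ
        ((g (i + 1)).quotKerEquivOfSurjective (hsurj (i + 1))).symm.toLinearMap
      obtain ⟨h', hh'⟩ := hext (i + 1 + 1) Q hQ hQ' h1
      refine ⟨h', LinearMap.ext fun y => ?_⟩
      have := LinearMap.congr_fun hh' (g (i + 1) y)
      have e : ((g (i + 1)).quotKerEquivOfSurjective (hsurj (i + 1))).symm (g (i + 1) y) =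
          (LinearMap.ker (g (i + 1))).mkQ y := by
        rw [LinearEquiv.symm_apply_eq]; rfl
      simp only [LinearMap.comp_apply, h1, LinearEquiv.coe_coe, e] at this ⊢
      simpa using this
    · rintro ⟨h', rfl⟩
      ext y
      simp [hcomp]
  · have hr : LinearMap.range (f 0) = LinearMap.ker (f (0 + 1) ∘ₗ g 0) := by
      rw [LinearMap.ker_comp_of_ker_eq_bot _ (LinearMap.ker_eq_bot.2 (hinj _))]
      exact (LinearMap.exact_iff.1 (hex 0)).symm
    exact ⟨(LinearEquiv.ofInjective (f 0) (hinj 0)).trans (LinearEquiv.ofEq _ _ hr)⟩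

/-- The class consists of all kernels of differentials in a complete resolution of `G`, up to
isomorphism. -/
theorem IsGproj.exists_isSyzygyClosed {G : Type u} [AddCommGroup G] [Module A G]
    (hG : IsGproj A G) :
    ∃ W : ModuleCat.{u} A → Prop, IsSyzygyClosed W ∧ W (ModuleCat.of A G) := by
  obtain ⟨P, d, hP, hex, hhom, hiso⟩ := hG
  have step : ∀ (X Y : ModuleCat.{u} A) (i : ℤ) (_ : X ≃ₗ[A] LinearMap.ker (d i))
      (_ : Y ≃ₗ[A] LinearMap.ker (d (i + 1))), IsProjExtension X Y := by
    intro X Y i a b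
    obtain ⟨j, rfl⟩ : ∃ j : ℤ, i = j + 1 + 1 := ⟨i - 2, by ring⟩
    have hd : ∀ i x, d (i + 1) (d i x) = 0 := fun i x => (hex i).apply_apply_eq_zero x
    refine ⟨P (j + 1 + 1), (LinearMap.ker _).subtype ∘ₗ a.toLinearMap,
      b.symm.toLinearMap ∘ₗ (d (j + 1 + 1)).codRestrict _ (fun x => hd _ x),
      (hP _).1, (hP _).2, ?_, ?_, ?_, ?_⟩
    · exact Subtype.val_injective.comp a.injective
    · intro x
      simp only [LinearMap.comp_apply, LinearEquiv.coe_coe, LinearEquiv.map_eq_zero_iff]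
      constructor
      · intro h
        exact ⟨a.symm ⟨x, congrArg Subtype.val h⟩, by simp⟩
      · rintro ⟨y, rfl⟩
        exact Subtype.ext (a y).2
    · rw [LinearMap.coe_comp]
      refine b.symm.surjective.comp fun y => ?_
      obtain ⟨x, hx⟩ := (hex _ _).1 y.2
      exact ⟨x, Subtype.ext hx⟩
    · intro Q _ _ hQ hQ' h
      obtain ⟨h', hh'⟩ := (hhom Q hQ hQ' j
        (h ∘ₗ a.symm.toLinearMap ∘ₗ (d (j + 1)).codRestrict _ (fun x => hd _ x))).1 (by
          ext x
          have : (d (j + 1)).codRestrict (LinearMap.ker (d (j + 1 + 1))) (fun x => hd _ x)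
            (d j x) = 0 := Subtype.ext (hd _ x)
          simp [this])
      refine ⟨h', LinearMap.ext fun x => ?_⟩
      obtain ⟨y, hy⟩ := (hex _ _).1 (a x).2
      have h1 := LinearMap.congr_fun hh' y
      have h2 : (d (j + 1)).codRestrict (LinearMap.ker (d (j + 1 + 1))) (fun x => hd _ x) y =
        a x := Subtype.ext hy
      simp only [LinearMap.comp_apply, h2, hy] at h1
      simpa using h1
  refine ⟨fun X => ∃ i, Nonempty (X ≃ₗ[A] LinearMap.ker (d i)), ⟨?_, ?_⟩, 0, hiso⟩
  · rintro X ⟨i, ⟨a⟩⟩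
    exact ⟨ModuleCat.of A (LinearMap.ker (d (i + 1))), ⟨_, ⟨LinearEquiv.refl _ _⟩⟩,
      step _ _ i a (LinearEquiv.refl _ _)⟩
  · rintro X ⟨i, ⟨a⟩⟩
    obtain ⟨j, rfl⟩ : ∃ j : ℤ, i = j + 1 := ⟨i - 1, by ring⟩
    exact ⟨ModuleCat.of A (LinearMap.ker (d j)), ⟨_, ⟨LinearEquiv.refl _ _⟩⟩,
      step _ _ j (LinearEquiv.refl _ _) a⟩

theorem IsProjExtension.prod {X X' : ModuleCat.{u} A} (h : IsProjExtension X X')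
    (Q : ModuleCat.{u} A) [Module.Finite A Q] [Module.Projective A Q] :
    IsProjExtension (ModuleCat.of A (X × Q)) X' ∧ IsProjExtension X (ModuleCat.of A (X' × Q)) := by
  obtain ⟨P, f, g, hfin, hproj, hinj, hex, hsurj, hext⟩ := h
  constructor
  · refine ⟨ModuleCat.of A (P × Q), f.prodMap LinearMap.id, g ∘ₗ LinearMap.fst A P Q,
      inferInstance, inferInstance, ?_, ?_, ?_, ?_⟩
    · exact hinj.prodMap Function.injective_id
    · rintro ⟨p, q⟩
      refine (hex p).trans ⟨?_, ?_⟩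
      · rintro ⟨x, rfl⟩; exact ⟨(x, q), rfl⟩
      · rintro ⟨⟨x, y⟩, h⟩; exact ⟨x, congrArg Prod.fst h⟩
    · exact hsurj.comp Prod.fst_surjective
    · intro R _ _ hR hR' h
      obtain ⟨h', hh'⟩ := hext R hR hR' (h ∘ₗ LinearMap.inl A X Q)
      refine ⟨h'.coprod (h ∘ₗ LinearMap.inr A X Q), ?_⟩
      apply LinearMap.prod_ext
      · rw [← hh']
        ext x
        change h' (f x) + h 0 = h' (f x)
        rw [map_zero, add_zero]
      · ext x
        change h' (f 0) + h (0, x) = h (0, x)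
        rw [map_zero, map_zero, zero_add]
  · refine ⟨ModuleCat.of A (P × Q), LinearMap.inl A P Q ∘ₗ f, g.prodMap LinearMap.id,
      inferInstance, inferInstance, ?_, ?_, ?_, ?_⟩
    · exact LinearMap.inl_injective.comp hinj
    · rintro ⟨p, q⟩
      constructor
      · intro h
        obtain ⟨x, hx⟩ := (hex p).1 (congrArg Prod.fst h)
        have : q = 0 := congrArg Prod.snd h
        exact ⟨x, by simp [hx, this]⟩
      · rintro ⟨x, hx⟩
        obtain ⟨rfl, rfl⟩ := Prod.mk.inj hx
        exact Prod.ext (hex.apply_apply_eq_zero x) rfl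
    · exact hsurj.prodMap Function.surjective_id
    · intro R _ _ hR hR' h
      obtain ⟨h', hh'⟩ := hext R hR hR' h
      exact ⟨h' ∘ₗ LinearMap.fst A P Q, by rw [← hh']; rfl⟩

/-- `X` is a retract of `Y`. -/
def IsRetractOf (X Y : ModuleCat.{u} A) : Prop :=
  ∃ (ι : X →ₗ[A] Y) (ρ : Y →ₗ[A] X), ρ ∘ₗ ι = LinearMap.id

/-- Take `X' = P / f(ι X)`. If `e` extends `f ι ρ` to `P`, then `p ↦ (g p, p - e p)` embeds `X'` in
`G' × P`, and `(g p, q) ↦ [e p + q]` is a retraction. -/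
theorem IsProjExtension.retract_right {G G' X : ModuleCat.{u} A} (h : IsProjExtension G G')
    (hX : IsRetractOf X G) :
    ∃ X' P : ModuleCat.{u} A, Module.Finite A P ∧ Module.Projective A P ∧
      IsRetractOf X' (ModuleCat.of A (G' × P)) ∧ IsProjExtension X X' := by
  obtain ⟨P, f, g, hfin, hproj, hinj, hex, hsurj, hext⟩ := h
  obtain ⟨ι, ρ, hρ⟩ := hX
  have hρ' : ∀ x, ρ (ι x) = x := LinearMap.congr_fun hρ
  have hι : Function.Injective ι := Function.LeftInverse.injective hρ'
  obtain ⟨e, he⟩ := hext P hfin hproj (f ∘ₗ ι ∘ₗ ρ)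
  have he' : ∀ x, e (f x) = f (ι (ρ x)) := LinearMap.congr_fun he
  set N := LinearMap.range (f ∘ₗ ι) with hN
  refine ⟨ModuleCat.of A (P ⧸ N), P, hfin, hproj, ?_, ?_⟩
  · let α : (P ⧸ N) →ₗ[A] G' × P := N.liftQ (g.prod (LinearMap.id - e)) (by
      rintro _ ⟨x, rfl⟩
      simp [he', hρ', hex.apply_apply_eq_zero])
    have hk : LinearMap.ker g ≤ LinearMap.ker (N.mkQ ∘ₗ e) := by
      intro y hy
      obtain ⟨x, rfl⟩ := (hex y).1 hy
      have : e (f x) ∈ N := ⟨ρ x, (he' x).symm⟩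
      simpa using this
    let β : G' →ₗ[A] P ⧸ N := (LinearMap.ker g).liftQ (N.mkQ ∘ₗ e) hk ∘ₗ
        (g.quotKerEquivOfSurjective hsurj).symm.toLinearMap
    have hβ : ∀ p, β (g p) = N.mkQ (e p) := fun p => by
      have e' : (g.quotKerEquivOfSurjective hsurj).symm (g p) = (LinearMap.ker g).mkQ p := by
        rw [LinearEquiv.symm_apply_eq]; rfl
      simp only [β, LinearMap.comp_apply, LinearEquiv.coe_coe, e']
      rfl
    refine ⟨α, β.coprod N.mkQ, ?_⟩
    apply Submodule.linearMap_qext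
    ext p
    have hα : α (N.mkQ p) = (g p, p - e p) := rfl
    simp only [LinearMap.comp_apply, hα, LinearMap.coprod_apply, hβ, ← map_add]
    simp
  · refine ⟨P, f ∘ₗ ι, N.mkQ, hfin, hproj, hinj.comp hι, ?_, N.mkQ_surjective, ?_⟩
    · rw [LinearMap.exact_iff, Submodule.ker_mkQ]
    · intro Q _ _ hQ hQ' h
      obtain ⟨h', hh'⟩ := hext Q hQ hQ' (h ∘ₗ ρ)
      refine ⟨h', LinearMap.ext fun x => ?_⟩
      simpa [hρ'] using LinearMap.congr_fun hh' (ι x)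

/-- Dually, take `X' = Ker (ρ g)` and let `e` lift `ι ρ g` along `g`. On `X'` the map `e` lands in
`f(G')`, while `1 - e` maps `P` into `X'`; the two add up to the identity of `X'`. -/
theorem IsProjExtension.retract_left {G G' X : ModuleCat.{u} A} (h : IsProjExtension G' G)
    (hX : IsRetractOf X G) :
    ∃ X' P : ModuleCat.{u} A, Module.Finite A P ∧ Module.Projective A P ∧
      IsRetractOf X' (ModuleCat.of A (G' × P)) ∧ IsProjExtension X' X := by
  obtain ⟨P, f, g, hfin, hproj, hinj, hex, hsurj, hext⟩ := h
  obtain ⟨ι, ρ, hρ⟩ := hX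
  have hρ' : ∀ x, ρ (ι x) = x := LinearMap.congr_fun hρ
  have hι : Function.Injective ι := Function.LeftInverse.injective hρ'
  obtain ⟨e, he⟩ := Module.projective_lifting_property g (ι ∘ₗ ρ ∘ₗ g) hsurj
  have he' : ∀ x, g (e x) = ι (ρ (g x)) := LinearMap.congr_fun he
  set N := LinearMap.ker (ρ ∘ₗ g) with hN
  have hNmem : ∀ x, x ∈ N ↔ ρ (g x) = 0 := fun x => Iff.rfl
  let c : P →ₗ[A] N := (LinearMap.id - e).codRestrict N (fun p => by
    simp [hNmem, he', hρ'])
  let b : G' →ₗ[A] N := f.codRestrict N (fun x => by simp [hNmem, hex.apply_apply_eq_zero])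
  have hr : ∀ x : N, e x ∈ LinearMap.range f := fun x =>
    (hex _).1 (by rw [he', (hNmem _).1 x.2, map_zero])
  let a : N →ₗ[A] G' := (LinearEquiv.ofInjective f hinj).symm.toLinearMap ∘ₗ
    (e ∘ₗ N.subtype).codRestrict (LinearMap.range f) hr
  have ha : ∀ x : N, f (a x) = e x := fun x => by
    have := (LinearEquiv.ofInjective f hinj).apply_symm_apply
      ((e ∘ₗ N.subtype).codRestrict (LinearMap.range f) hr x)
    exact congrArg Subtype.val this
  refine ⟨ModuleCat.of A N, P, hfin, hproj, ⟨a.prod N.subtype, b.coprod c, ?_⟩, P, N.subtype,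
    ρ ∘ₗ g, hfin, hproj, N.subtype_injective, ?_, ?_, ?_⟩
  · ext x
    change f (a x) + ((x : P) - e x) = x
    rw [ha]
    abel
  · rw [LinearMap.exact_iff, Submodule.range_subtype]
  · exact (Function.RightInverse.surjective hρ').comp hsurj
  · intro Q _ _ hQ hQ' h
    obtain ⟨h1, hh1⟩ := hext Q hQ hQ' (h ∘ₗ b)
    -- Extend the two parts of `h` separately, following the splitting `b a + c = 1` on `N`.
    refine ⟨h1 ∘ₗ e + h ∘ₗ c, LinearMap.ext fun x => ?_⟩
    have h2 : h1 (f (a x)) = h (b (a x)) := LinearMap.congr_fun hh1 (a x)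
    have h3 : b (a x) + c x = x := Subtype.ext (by
      change f (a x) + ((x : P) - e x) = x
      rw [ha]
      abel)
    change h1 (e x) + h (c x) = h x
    rw [← ha, h2, ← map_add, h3]

/-- The projective factor `Q` is what makes the class stable: passing to a retract produces a new
end that is a retract only after adding a projective. -/
theorem IsSyzygyClosed.retracts {W : ModuleCat.{u} A → Prop} (hW : IsSyzygyClosed W) :
    IsSyzygyClosed fun X => ∃ Y Q : ModuleCat.{u} A, W Y ∧ Module.Finite A Q ∧
      Module.Projective A Q ∧ IsRetractOf X (ModuleCat.of A (Y × Q)) := by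
  constructor
  · rintro X ⟨Y, Q, hY, _, _, hX⟩
    obtain ⟨Y', hY', hs⟩ := hW.right Y hY
    obtain ⟨X', P, hP, hP', hr, hs'⟩ := (hs.prod Q).1.retract_right hX
    exact ⟨X', ⟨Y', P, hY', hP, hP', hr⟩, hs'⟩
  · rintro X ⟨Y, Q, hY, _, _, hX⟩
    obtain ⟨Y', hY', hs⟩ := hW.left Y hY
    obtain ⟨X', P, hP, hP', hr, hs'⟩ := (hs.prod Q).2.retract_left hX
    exact ⟨X', ⟨Y', P, hY', hP, hP', hr⟩, hs'⟩

/-- Gorenstein-projective modules are closed under direct summands. -/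
theorem IsGproj.of_retract {G X : Type u} [AddCommGroup G] [Module A G] [AddCommGroup X]
    [Module A X] (hG : IsGproj A G) (ι : X →ₗ[A] G) (ρ : G →ₗ[A] X) (h : ρ ∘ₗ ι = LinearMap.id) :
    IsGproj A X := by
  obtain ⟨W, hW, hWG⟩ := hG.exists_isSyzygyClosed
  refine hW.retracts.isGproj (ModuleCat.of A X) ⟨ModuleCat.of A G, ModuleCat.of A PUnit, hWG,
    inferInstanceAs (Module.Finite A PUnit.{u + 1}), inferInstanceAs (Module.Projective A PUnit.{u + 1}),
    LinearMap.inl A G PUnit.{u + 1} ∘ₗ ι, ρ ∘ₗ LinearMap.fst A G PUnit.{u + 1}, ?_⟩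
  ext x
  exact LinearMap.congr_fun h x

/-- Finitely generated projective modules are Gorenstein-projective. -/
theorem IsGproj.of_projective (P : Type u) [AddCommGroup P] [Module A P] [Module.Finite A P]
    [Module.Projective A P] : IsGproj A P := by
  have hW : IsSyzygyClosed fun X : ModuleCat.{u} A =>
      Module.Finite A X ∧ Module.Projective A X := by
    have h0 : Module.Finite A (ModuleCat.of A PUnit.{u + 1}) ∧
        Module.Projective A (ModuleCat.of A PUnit.{u + 1}) :=
      ⟨inferInstanceAs (Module.Finite A PUnit.{u + 1}), inferInstanceAs (Module.Projective A PUnit.{u + 1})⟩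
    constructor
    · rintro X ⟨hX, hX'⟩
      refine ⟨ModuleCat.of A PUnit, h0, X, LinearMap.id, 0, hX, hX', Function.injective_id,
        fun x => ?_, fun x => ⟨0, rfl⟩, fun Q _ _ _ _ h => ⟨h, rfl⟩⟩
      exact ⟨fun _ => ⟨x, rfl⟩, fun _ => rfl⟩
    · rintro X ⟨hX, hX'⟩
      refine ⟨ModuleCat.of A PUnit, h0, X, 0, LinearMap.id, hX, hX',
        Function.injective_of_subsingleton _, fun x => ?_, Function.surjective_id,
        fun Q _ _ _ _ h => ⟨0, ?_⟩⟩
      · simp [eq_comm]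
      · ext x
        have : x = 0 := rfl
        simp [this]
  exact hW.isGproj (ModuleCat.of A P) ⟨inferInstance, inferInstance⟩

/-! ### Modules in `add E` -/

/-- `G` is a direct summand of a finite direct sum of copies of `E`: the identity of `G` is a sum
of endomorphisms that factor through `E`. -/
def InAdd (E G : Type*) [AddCommGroup E] [Module A E] [AddCommGroup G] [Module A G] : Prop :=
  ∃ (m : ℕ) (a : Fin m → G →ₗ[A] E) (b : Fin m → E →ₗ[A] G), ∑ j, b j ∘ₗ a j = LinearMap.id

theorem InAdd.of_two {E G X Y : Type*} [AddCommGroup E] [Module A E] [AddCommGroup G] [Module A G]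
    [AddCommGroup X] [Module A X] [AddCommGroup Y] [Module A Y] (hX : InAdd (A := A) E X)
    (hY : InAdd (A := A) E Y) (i : X →ₗ[A] G) (p : G →ₗ[A] X) (j : Y →ₗ[A] G) (q : G →ₗ[A] Y)
    (h : i ∘ₗ p + j ∘ₗ q = LinearMap.id) : InAdd (A := A) E G := by
  obtain ⟨m, a, b, hab⟩ := hX
  obtain ⟨m', a', b', hab'⟩ := hY
  refine ⟨m + m', Fin.append (fun l => a l ∘ₗ p) (fun l => a' l ∘ₗ q),
    Fin.append (fun l => i ∘ₗ b l) (fun l => j ∘ₗ b' l), LinearMap.ext fun x => ?_⟩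
  have h1 := LinearMap.congr_fun hab (p x)
  have h2 := LinearMap.congr_fun hab' (q x)
  have h3 := LinearMap.congr_fun h x
  simp only [LinearMap.sum_apply, LinearMap.comp_apply, LinearMap.add_apply,
    LinearMap.id_apply] at h1 h2 h3 ⊢
  simp only [Fin.sum_univ_add, Fin.append_left, Fin.append_right, LinearMap.comp_apply, ← map_sum,
    h1, h2, h3]

/-- Induction on length: a nontrivial idempotent splits `G` into two shorter summands, again
Gorenstein-projective; otherwise `G` is zero or in the list. -/
theorem IsGprojList.inAdd [IsArtinianRing A] {n : ℕ} {E : Fin n → Type u}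
    [∀ i, AddCommGroup (E i)] [∀ i, Module A (E i)] (hE : IsGprojList A E) (G : Type u)
    [AddCommGroup G] [Module A G] [Module.Finite A G] (hG : IsGproj A G) :
    InAdd (A := A) (∀ i, E i) G := by
  induction hl : Module.length A G using WellFoundedLT.induction generalizing G with
  | _ l ih =>
  subst hl
  rcases subsingleton_or_nontrivial G with hs | hn
  · exact ⟨0, Fin.elim0, Fin.elim0, Subsingleton.elim _ _⟩
  by_cases hi : ∀ e : G →ₗ[A] G, e ∘ₗ e = e → e = 0 ∨ e = LinearMap.id
  · obtain ⟨i, ⟨φ⟩⟩ := hE.complete G inferInstance hG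
      ((indecomposable_iff_idempotents (ModuleCat.of A G)).2 ⟨hn, hi⟩)
    exact ⟨1, fun _ => LinearMap.single A E i ∘ₗ φ.toLinearMap,
      fun _ => φ.symm.toLinearMap ∘ₗ LinearMap.proj i, by ext x; simp⟩
  · push Not at hi
    obtain ⟨e, he, h0, h1⟩ := hi
    have he' : ∀ x, e (e x) = e x := LinearMap.congr_fun he
    have h2 : (LinearMap.id - e) ∘ₗ (LinearMap.id - e) = LinearMap.id - e := by
      ext x; simp [he']
    have key : ∀ c : G →ₗ[A] G, c ∘ₗ c = c → c ≠ LinearMap.id →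
        InAdd (A := A) (∀ i, E i) (LinearMap.range c) := by
      intro c hc hc1
      refine ih _ (Submodule.length_lt fun ht => hc1 ?_) (LinearMap.range c)
        (hG.of_retract (LinearMap.range c).subtype c.rangeRestrict ?_) rfl
      · ext x
        obtain ⟨y, rfl⟩ := LinearMap.range_eq_top.1 ht x
        exact LinearMap.congr_fun hc y
      · ext ⟨x, y, rfl⟩
        exact LinearMap.congr_fun hc y
    refine (key e he h1).of_two (key _ h2 fun h => h0 ?_)
      (LinearMap.range e).subtype e.rangeRestrict
      (LinearMap.range (LinearMap.id - e)).subtype (LinearMap.id - e).rangeRestrict ?_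
    · simpa using h
    · ext x; simp

end Gproj

/-! ### τ-rigidity from a projective presentation -/

theorem InAdd.of_projective {B : Type*} [Ring B] (P : Type*) [AddCommGroup P] [Module B P]
    [Module.Finite B P] [Module.Projective B P] : InAdd (A := B) B P := by
  obtain ⟨m, π, hπ⟩ := Module.Finite.exists_fin' B P
  obtain ⟨σ, hσ⟩ := Module.projective_lifting_property π LinearMap.id hπ
  refine ⟨m, fun j => LinearMap.proj j ∘ₗ σ, fun j => π ∘ₗ LinearMap.single B (fun _ => B) j, ?_⟩
  ext x
  simp only [LinearMap.sum_apply, LinearMap.comp_apply, ← map_sum]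
  rw [← hσ, LinearMap.comp_apply]
  congr 1
  ext j
  simp [Pi.single_apply]

section Pairing

variable {k : Type v} [Field k] {B : Type u} [Ring B] [Algebra k B]

theorem NakayamaDual.smul_toDual {P : Type u} [AddCommGroup P] [Module B P] (b : B)
    (φ : NakayamaDual k B P) (h : P →ₗ[B] B) :
    (b • φ).toDual h = φ.toDual (MulOpposite.op b • h) := rfl

theorem NakayamaDual.add_toDual {P : Type u} [AddCommGroup P] [Module B P]
    (φ ψ : NakayamaDual k B P) (h : P →ₗ[B] B) :
    (φ + ψ).toDual h = φ.toDual h + ψ.toDual h := rfl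

theorem NakayamaDual.sum_toDual {P : Type u} [AddCommGroup P] [Module B P] {ι : Type*}
    (s : Finset ι) (φ : ι → NakayamaDual k B P) (h : P →ₗ[B] B) :
    (∑ i ∈ s, φ i).toDual h = ∑ i ∈ s, (φ i).toDual h := by
  classical
  induction s using Finset.induction_on with
  | empty => rfl
  | insert i s hi ih => rw [Finset.sum_insert hi, Finset.sum_insert hi, add_toDual, ih]

/-- If every map `P₁ ⟶ N` factors through `f : P₁ ⟶ P₀`, then there are no nonzero maps from `N`
to the kernel of `D Hom(P₁, B) ⟶ D Hom(P₀, B)`. -/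
theorem hom_tauOfPresentation_eq_zero {P₁ P₀ N : Type u} [AddCommGroup P₁] [Module B P₁]
    [AddCommGroup P₀] [Module B P₀] [AddCommGroup N] [Module B N] [Module.Finite B P₁]
    [Module.Projective B P₁] [Module.Finite B P₀] [Module.Projective B P₀] (f : P₁ →ₗ[B] P₀)
    (hf : ∀ h : P₁ →ₗ[B] N, ∃ h' : P₀ →ₗ[B] N, h' ∘ₗ f = h)
    (g : N →ₗ[B] tauOfPresentation k f) : g = 0 := by
  obtain ⟨m, a, b, hab⟩ := InAdd.of_projective (B := B) P₁
  obtain ⟨l, c, d, hcd⟩ := InAdd.of_projective (B := B) P₀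
  have hab' : ∀ x, ∑ i, a i x • b i 1 = x := fun x => by
    simpa [← map_smul] using LinearMap.congr_fun hab x
  have hcd' : ∀ x, ∑ i, c i x • d i 1 = x := fun x => by
    simpa [← map_smul] using LinearMap.congr_fun hcd x
  let G : N →ₗ[B] NakayamaDual k B P₁ := (tauOfPresentation k f).subtype ∘ₗ g
  have hG : ∀ n (φ : P₀ →ₗ[B] B), (G n).toDual (φ ∘ₗ f) = 0 := fun n φ =>
    congrArg (fun ω : NakayamaDual k B P₀ => ω.toDual φ) (LinearMap.mem_ker.1 (g n).2)
  -- `ψ` corresponds to `G` under `Hom(N, D Hom(P₁, B)) ≅ D Hom(P₁, N)`, computed in the dual basis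
  -- `a i`, `b i 1`. It vanishes on maps factoring through `f`, hence on everything by `hf`.
  let ψ : (P₁ →ₗ[B] N) → k := fun h => ∑ i, (G (h (b i 1))).toDual (a i)
  have h1 : ∀ (φ : P₁ →ₗ[B] B) (n : N), ψ (φ.smulRight n) = (G n).toDual φ := by
    intro φ n
    simp only [ψ, LinearMap.smulRight_apply, map_smul, NakayamaDual.smul_toDual, ← map_sum]
    congr 1
    ext x
    conv_rhs => rw [← hab' x]
    simp
  have h2 : ∀ h' : P₀ →ₗ[B] N, ψ (h' ∘ₗ f) = 0 := by
    intro h'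
    have e : ∀ x, h' (f x) = ∑ j, c j (f x) • h' (d j 1) := fun x => by
      conv_lhs => rw [← hcd' (f x)]
      simp only [map_sum, map_smul]
    simp only [ψ, LinearMap.comp_apply, e, map_sum, map_smul, NakayamaDual.sum_toDual,
      NakayamaDual.smul_toDual]
    rw [Finset.sum_comm]
    refine Finset.sum_eq_zero fun j _ => ?_
    rw [← hG (h' (d j 1)) (c j), ← map_sum]
    congr 1
    ext x
    conv_rhs => rw [← hab' x]
    simp
  refine LinearMap.ext fun n => Subtype.ext (LinearMap.ext fun φ => ?_)
  obtain ⟨h', hh'⟩ := hf (LinearMap.smulRight φ n)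
  have := h1 φ n
  rw [← hh', h2] at this
  exact this.symm

end Pairing

/-! ### Right minimal versions -/

/-- Fitting's lemma and induction on length: if `g c = g` with `c` not bijective, then `g` vanishes
on the kernel of a high power of `c`, and the image of that power is a proper summand. -/
theorem exists_isRightMinimal_retract {B : Type u} [Ring B] [IsArtinianRing B] {M : Type u}
    [AddCommGroup M] [Module B M] (X : Type u) [AddCommGroup X] [Module B X] [Module.Finite B X]
    (g : X →ₗ[B] M) :
    ∃ (Y : ModuleCat.{u} B) (ι : Y →ₗ[B] X) (ρ : X →ₗ[B] Y), ρ ∘ₗ ι = LinearMap.id ∧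
      g ∘ₗ ι ∘ₗ ρ = g ∧ IsRightMinimal (g ∘ₗ ι) := by
  induction hl : Module.length B X using WellFoundedLT.induction generalizing X with
  | _ l ih =>
  subst hl
  by_cases hg : IsRightMinimal g
  · exact ⟨ModuleCat.of B X, LinearMap.id, LinearMap.id, rfl, rfl, hg⟩
  unfold IsRightMinimal at hg
  push Not at hg
  obtain ⟨c, hc, hb⟩ := hg
  -- Positivity of `n` lets surjectivity of `c ^ n` imply that of `c`.
  obtain ⟨n, hn0, hn⟩ :=
    ((Filter.eventually_gt_atTop 0).and (LinearMap.eventually_isCompl_ker_pow_range_pow c)).exists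
  have hgn : ∀ x, g ((c ^ n) x) = g x := fun x => by
    clear hn hn0
    induction n with
    | zero => rfl
    | succ n ih => rw [pow_succ', Module.End.mul_apply]; exact (LinearMap.congr_fun hc _).trans ih
  set R := LinearMap.range (c ^ n)
  have hR : R ≠ ⊤ := fun h => hb <| by
    have hs : Function.Surjective c := by
      have := LinearMap.range_eq_top.1 h
      rw [← Nat.succ_pred_eq_of_pos hn0, pow_succ', Module.End.mul_eq_comp, LinearMap.coe_comp]
        at this
      exact this.of_comp
    exact IsNoetherian.bijective_of_surjective_endomorphism c hs
  obtain ⟨Y, ι, ρ, h1, h2, h3⟩ := ih _ (Submodule.length_lt hR) R (g ∘ₗ R.subtype) rfl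
  let π : X →ₗ[B] R := R.projectionOnto _ hn.symm
  have hπ : ∀ x, g (π x) = g x := fun x => by
    have hx : x - π x ∈ LinearMap.ker (c ^ n) := by
      rw [← Submodule.ker_projectionOnto hn.symm, LinearMap.mem_ker, map_sub,
        Submodule.projectionOnto_apply_left, sub_self]
    have := hgn (x - π x)
    rw [LinearMap.mem_ker.1 hx, map_zero, map_sub] at this
    exact (sub_eq_zero.1 this.symm).symm
  refine ⟨Y, R.subtype ∘ₗ ι, ρ ∘ₗ π, ?_, ?_, h3⟩
  · ext y
    have : π (ι y) = ι y := Submodule.projectionOnto_apply_left hn.symm (ι y)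
    simpa [this] using LinearMap.congr_fun h1 y
  · ext x
    exact (LinearMap.congr_fun h2 (π x)).trans (hπ x)

theorem Module.finite_of_retract {B X Y : Type*} [Ring B] [AddCommGroup X] [Module B X]
    [AddCommGroup Y] [Module B Y] [Module.Finite B X] (ι : Y →ₗ[B] X) (ρ : X →ₗ[B] Y)
    (h : ρ ∘ₗ ι = LinearMap.id) : Module.Finite B Y :=
  Module.Finite.of_surjective ρ (Function.RightInverse.surjective (LinearMap.congr_fun h))

/-- A module with a projective presentation `f` such that `Hom(f, N)` is surjective is τ-rigid. -/
theorem IsTauRigid.of_presentation (k : Type v) [Field k] {B : Type u} [Ring B] [Algebra k B]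
    [IsArtinianRing B] {P₁ P₀ N : Type u} [AddCommGroup P₁] [Module B P₁]
    [AddCommGroup P₀] [Module B P₀] [AddCommGroup N] [Module B N] [Module.Finite B P₁]
    [Module.Projective B P₁] [Module.Finite B P₀] [Module.Projective B P₀] (f : P₁ →ₗ[B] P₀)
    (p : P₀ →ₗ[B] N) (hex : Function.Exact f p) (hp : Function.Surjective p)
    (hf : ∀ h : P₁ →ₗ[B] N, ∃ h' : P₀ →ₗ[B] N, h' ∘ₗ f = h) : IsTauRigid k B N := by
  obtain ⟨Y₀, ι₀, ρ₀, hr₀, hg₀, hm₀⟩ := exists_isRightMinimal_retract P₀ p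
  obtain ⟨Y₁, ι₁, ρ₁, hr₁, hg₁, hm₁⟩ := exists_isRightMinimal_retract P₁ (ρ₀ ∘ₗ f)
  have hr₀' : ∀ x, ρ₀ (ι₀ x) = x := LinearMap.congr_fun hr₀
  have hg₀' : ∀ x, p (ι₀ (ρ₀ x)) = p x := LinearMap.congr_fun hg₀
  have hg₁' : ∀ x, ρ₀ (f (ι₁ (ρ₁ x))) = ρ₀ (f x) := LinearMap.congr_fun hg₁
  have := Module.finite_of_retract _ _ hr₀
  have := Module.finite_of_retract _ _ hr₁
  have := Module.Projective.of_split _ _ hr₀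
  have := Module.Projective.of_split _ _ hr₁
  -- `s` lifts the projection onto the superfluous summand of `P₀`
  obtain ⟨s, hs⟩ := Module.projective_lifting_property f.rangeRestrict
    ((LinearMap.id - ι₀ ∘ₗ ρ₀).codRestrict (LinearMap.range f)
      (fun x => (hex _).1 (by simp [hg₀']))) f.surjective_rangeRestrict
  have hs' : ∀ x, f (s x) = x - ι₀ (ρ₀ x) := fun x =>
    congrArg Subtype.val (LinearMap.congr_fun hs x)
  -- `r` corrects `f` to land in the summand `Y₀`: `f r = ι₀ ρ₀ f`. Hence `ρ₁ r ι₁` fixes `ρ₀ f ι₁`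
  -- and is an automorphism by minimality.
  let r : P₁ →ₗ[B] P₁ := LinearMap.id - s ∘ₗ f
  have hr : ∀ x, f (r x) = ι₀ (ρ₀ (f x)) := fun x => by
    simp [r, hs']
  have hc : Function.Bijective (ρ₁ ∘ₗ r ∘ₗ ι₁) := hm₁ _ (by
    ext x
    simp [hg₁', hr, hr₀'])
  refine ⟨Y₁, Y₀, ρ₀ ∘ₗ f ∘ₗ ι₁, p ∘ₗ ι₀,
    ⟨‹_›, ‹_›, ‹_›, ‹_›, fun y => ⟨fun h => ?_, ?_⟩, fun n => ?_, fun e he => hm₁ e ?_, hm₀⟩,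
    hom_tauOfPresentation_eq_zero _ fun h => ?_⟩
  · obtain ⟨x, hx⟩ := (hex _).1 h
    exact ⟨ρ₁ x, by simp [hg₁', hx, hr₀']⟩
  · rintro ⟨x, rfl⟩
    simp [hg₀', hex.apply_apply_eq_zero]
  · obtain ⟨x, rfl⟩ := hp n
    exact ⟨ρ₀ x, hg₀' x⟩
  · ext x
    exact congrArg Subtype.val (LinearMap.congr_fun he x)
  · let c := LinearEquiv.ofBijective _ hc
    -- Twisting by `c⁻¹` makes the factorization through `f`, evaluated on `r ι₁`, return `h`
    -- itself.
    obtain ⟨h₀, hh₀⟩ := hf (h ∘ₗ c.symm.toLinearMap ∘ₗ ρ₁)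
    refine ⟨h₀ ∘ₗ ι₀, LinearMap.ext fun x => ?_⟩
    have h1 := LinearMap.congr_fun hh₀ (r (ι₁ x))
    have h2 : c.symm (ρ₁ (r (ι₁ x))) = x := c.symm_apply_apply x
    simp only [LinearMap.comp_apply, hr, LinearEquiv.coe_coe, h2] at h1
    exact h1

/-! ### The functor `Hom_A(E, -)` -/

section Functor

variable {A : Type u} [Ring A] (E : Type u) [AddCommGroup E] [Module A E]

/-- The map `Hom_A(E, X) ⟶ Hom_A(E, Y)` induced by `h : X ⟶ Y`. -/
def homFromMap {X Y : Type u} [AddCommGroup X] [Module A X] [AddCommGroup Y] [Module A Y]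
    (h : X →ₗ[A] Y) : HomFrom A E X →ₗ[EndOp A E] HomFrom A E Y where
  toFun x := h ∘ₗ x.toHom
  map_add' x y := LinearMap.comp_add x.toHom y.toHom h
  map_smul' _ _ := rfl

variable {E}

section

variable {X Y Z : Type u} [AddCommGroup X] [Module A X] [AddCommGroup Y] [Module A Y]
  [AddCommGroup Z] [Module A Z]

theorem homFromMap_comp (g : Y →ₗ[A] Z) (h : X →ₗ[A] Y) :
    homFromMap E (g ∘ₗ h) = homFromMap E g ∘ₗ homFromMap E h := rfl

theorem homFromMap_id : homFromMap E (LinearMap.id : X →ₗ[A] X) = LinearMap.id := rfl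

theorem map_comp_end (φ : HomFrom A E X →ₗ[EndOp A E] HomFrom A E Y) (x : E →ₗ[A] X)
    (γ : E →ₗ[A] E) : (φ (x ∘ₗ γ : E →ₗ[A] X)).toHom = (φ x).toHom ∘ₗ γ :=
  φ.map_smul (MulOpposite.op γ) x

theorem toHom_map_sum (φ : HomFrom A E X →ₗ[EndOp A E] HomFrom A E Y) {ι : Type*} (s : Finset ι)
    (x : ι → E →ₗ[A] X) :
    (φ (∑ i ∈ s, x i : E →ₗ[A] X)).toHom = ∑ i ∈ s, (φ (x i)).toHom :=
  map_sum φ x s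

/-- `Hom_A(E, -)` is fully faithful on `add E`. -/
theorem exists_homFromMap_of_inAdd (hX : InAdd (A := A) E X)
    (φ : HomFrom A E X →ₗ[EndOp A E] HomFrom A E Y) : ∃ h : X →ₗ[A] Y, homFromMap E h = φ := by
  obtain ⟨m, a, b, hab⟩ := hX
  refine ⟨∑ j, (φ (b j)).toHom ∘ₗ a j, LinearMap.ext fun x => ?_⟩
  have hx : x.toHom = ∑ j, b j ∘ₗ (a j ∘ₗ x.toHom) := by
    ext e
    simpa using (LinearMap.congr_fun hab (x.toHom e)).symm
  change (∑ j, (φ (b j)).toHom ∘ₗ a j) ∘ₗ x.toHom = (φ x.toHom).toHom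
  conv_rhs => rw [hx]
  rw [toHom_map_sum]
  simp only [map_comp_end]
  ext e
  simp

theorem homFromMap_injective_of_inAdd (hX : InAdd (A := A) E X) {h h' : X →ₗ[A] Y}
    (H : homFromMap E h = homFromMap E h') : h = h' := by
  obtain ⟨m, a, b, hab⟩ := hX
  have H' : ∀ x : E →ₗ[A] X, h ∘ₗ x = h' ∘ₗ x := LinearMap.congr_fun H
  ext x
  have hx := LinearMap.congr_fun hab x
  simp only [LinearMap.sum_apply, LinearMap.comp_apply, LinearMap.id_apply] at hx
  rw [← hx, map_sum, map_sum]
  exact Finset.sum_congr rfl fun j _ => LinearMap.congr_fun (H' (b j)) (a j x)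

/-- `Hom_A(E, -)` is faithful if `E` is a generator. -/
theorem homFromMap_injective (hA : InAdd (A := A) E A) {h h' : X →ₗ[A] Y}
    (H : homFromMap E h = homFromMap E h') : h = h' := by
  refine LinearMap.ext fun x => ?_
  have := homFromMap_injective_of_inAdd hA (h := h ∘ₗ LinearMap.toSpanSingleton A X x)
    (h' := h' ∘ₗ LinearMap.toSpanSingleton A X x) (by rw [homFromMap_comp, H, homFromMap_comp])
  simpa using LinearMap.congr_fun this 1

/-- `Hom_A(E, -)` is full if `E` is a generator. -/
theorem exists_homFromMap (hA : InAdd (A := A) E A)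
    (φ : HomFrom A E X →ₗ[EndOp A E] HomFrom A E Y) : ∃ h : X →ₗ[A] Y, homFromMap E h = φ := by
  let r : X → A →ₗ[A] X := fun x => LinearMap.toSpanSingleton A X x
  -- An element of `X` is a map from `A`, which is in `add E`, where fullness is known. The map
  -- sought is `x ↦ t x 1`; uniqueness of `t x` gives linearity.
  choose t ht using fun x : X => exists_homFromMap_of_inAdd hA (φ ∘ₗ homFromMap E (r x))
  have uniq : ∀ x (t' : A →ₗ[A] Y), homFromMap E t' = φ ∘ₗ homFromMap E (r x) → t' = t x :=
    fun x t' h => homFromMap_injective_of_inAdd hA (h.trans (ht x).symm)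
  have hadd : ∀ x y, t x + t y = t (x + y) := fun x y => uniq _ _ <| by
    have e : homFromMap E (r (x + y)) = homFromMap E (r x) + homFromMap E (r y) := by
      refine LinearMap.ext fun z => LinearMap.ext fun e => ?_
      exact smul_add (z.toHom e) x y
    rw [e, LinearMap.comp_add, ← ht, ← ht]
    refine LinearMap.ext fun z => ?_
    exact LinearMap.add_comp z.toHom (t y) (t x)
  have hsmul : ∀ (a : A) x, t x ∘ₗ LinearMap.toSpanSingleton A A a = t (a • x) := fun a x =>
    uniq _ _ <| by
      have e : r (a • x) = r x ∘ₗ LinearMap.toSpanSingleton A A a := by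
        ext; simp [r]
      rw [e, homFromMap_comp, homFromMap_comp, ht, LinearMap.comp_assoc]
  refine ⟨{ toFun := fun x => t x 1, map_add' := fun x y => by rw [← hadd]; rfl,
            map_smul' := fun a x => ?_ }, LinearMap.ext fun z => LinearMap.ext fun e => ?_⟩
  · rw [← hsmul]
    simp [← map_smul]
  · change t (z.toHom e) 1 = (φ z).toHom e
    have h1 : t (z.toHom e) = (φ z).toHom ∘ₗ LinearMap.toSpanSingleton A E e := by
      refine (uniq _ _ (LinearMap.ext fun w => ?_)).symm
      have e1 : r (z.toHom e) = z.toHom ∘ₗ LinearMap.toSpanSingleton A E e := by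
        ext; simp [r]
      rw [e1]
      exact (map_comp_end φ z.toHom (LinearMap.toSpanSingleton A E e ∘ₗ w.toHom)).symm
    rw [h1]
    simp

theorem homFrom_equiv_iff (hA : InAdd (A := A) E A) :
    Nonempty (HomFrom A E X ≃ₗ[EndOp A E] HomFrom A E Y) ↔ Nonempty (X ≃ₗ[A] Y) := by
  constructor
  · rintro ⟨φ⟩
    obtain ⟨h, hh⟩ := exists_homFromMap hA φ.toLinearMap
    obtain ⟨h', hh'⟩ := exists_homFromMap hA φ.symm.toLinearMap
    refine ⟨LinearEquiv.ofLinearMap h h' (homFromMap_injective hA ?_) (homFromMap_injective hA ?_)⟩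
    · rw [homFromMap_comp, hh, hh', homFromMap_id]; ext1; simp
    · rw [homFromMap_comp, hh, hh', homFromMap_id]; ext1; simp
  · rintro ⟨e⟩
    refine ⟨LinearEquiv.ofLinearMap (homFromMap E e.toLinearMap) (homFromMap E e.symm.toLinearMap)
      ?_ ?_⟩
    · rw [← homFromMap_comp, ← homFromMap_id]; simp
    · rw [← homFromMap_comp, ← homFromMap_id]; simp

theorem indecomposable_homFrom (hA : InAdd (A := A) E A)
    (hX : Indecomposable (ModuleCat.of A X)) :
    Indecomposable (ModuleCat.of (EndOp A E) (HomFrom A E X)) := by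
  rw [indecomposable_iff_idempotents] at hX ⊢
  obtain ⟨hn, hX⟩ := hX
  refine ⟨?_, fun φ hφ => ?_⟩
  · by_contra hs
    rw [not_nontrivial_iff_subsingleton] at hs
    obtain ⟨x, hx⟩ := exists_ne (0 : X)
    exact hx (LinearMap.congr_fun (homFromMap_injective hA (h := LinearMap.id) (h' := 0)
      (LinearMap.ext fun _ => hs.elim _ _)) x)
  · obtain ⟨e, rfl⟩ := exists_homFromMap hA φ
    rcases hX e (homFromMap_injective hA hφ) with rfl | rfl
    · exact Or.inl (LinearMap.ext fun x => LinearMap.zero_comp x.toHom)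
    · exact Or.inr rfl

/-- The maps expressing `X` as a summand of `E^m` make `Hom_A(E, X)` a retract of a free module of
rank `m`. -/
theorem homFrom_finite_projective (hX : InAdd (A := A) E X) :
    Module.Finite (EndOp A E) (HomFrom A E X) ∧ Module.Projective (EndOp A E) (HomFrom A E X) := by
  obtain ⟨m, a, b, hab⟩ := hX
  let i : HomFrom A E X →ₗ[EndOp A E] (Fin m → EndOp A E) :=
    { toFun := fun x j => MulOpposite.op (a j ∘ₗ x.toHom)
      map_add' := fun x y => funext fun j =>
        congrArg MulOpposite.op (LinearMap.comp_add x.toHom y.toHom (a j))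
      map_smul' := fun _ _ => rfl }
  let b' : Fin m → HomFrom A E X := b
  let p : (Fin m → EndOp A E) →ₗ[EndOp A E] HomFrom A E X := Fintype.linearCombination _ b'
  have h : p ∘ₗ i = LinearMap.id := by
    refine LinearMap.ext fun x => LinearMap.ext fun e => ?_
    have h1 : (p (i x)).toHom = ∑ j, b j ∘ₗ (a j ∘ₗ x.toHom) := rfl
    have h2 := LinearMap.congr_fun hab (x.toHom e)
    refine (LinearMap.congr_fun h1 e).trans ?_
    simp only [LinearMap.sum_apply] at h2 ⊢
    exact h2
  exact ⟨Module.finite_of_retract i p h, Module.Projective.of_split i p h⟩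

theorem isRightMinimal_homFromMap (hX : InAdd (A := A) E X) (hA : InAdd (A := A) E A)
    (g : X →ₗ[A] Y) (hg : IsRightMinimal g) : IsRightMinimal (homFromMap E g) := by
  intro φ hφ
  obtain ⟨e, rfl⟩ := exists_homFromMap_of_inAdd hX φ
  have he := hg e (homFromMap_injective hA hφ)
  let e' := LinearEquiv.ofBijective e he
  refine Function.bijective_iff_has_inverse.2 ⟨homFromMap E e'.symm.toLinearMap,
    fun x => LinearMap.ext fun y => e'.symm_apply_apply _,
    fun x => LinearMap.ext fun y => e'.apply_symm_apply _⟩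

theorem isRightMinimal_rangeRestrict_iff {R X Y : Type*} [Ring R] [AddCommGroup X] [Module R X]
    [AddCommGroup Y] [Module R Y] (g : X →ₗ[R] Y) :
    IsRightMinimal g.rangeRestrict ↔ IsRightMinimal g := by
  refine forall_congr' fun e => imp_congr_left ⟨fun h => LinearMap.ext fun x => ?_,
    fun h => LinearMap.ext fun x => Subtype.ext ?_⟩
  · exact congrArg Subtype.val (LinearMap.congr_fun h x)
  · exact LinearMap.congr_fun h x

end

end Functor

/-! ### From proper Gorenstein-projective presentations to projective presentations -/

section Presentation

variable {A : Type u} [Ring A] {n : ℕ} {E : Fin n → Type u}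
  [∀ i, AddCommGroup (E i)] [∀ i, Module A (E i)]
  {G₁ G₀ M : Type u} [AddCommGroup G₁] [Module A G₁] [AddCommGroup G₀] [Module A G₀]
  [AddCommGroup M] [Module A M] {θ : G₁ →ₗ[A] G₀} {π : G₀ →ₗ[A] M}

theorem IsProperGprojPresentation.homFrom_surjective (h : IsProperGprojPresentation θ π)
    (hE : IsGprojList A E) : Function.Surjective (homFromMap (∀ i, E i) π) := by
  intro y
  choose l hl using fun i => h.hom_surjective (E i) (hE.finite i) (hE.gproj i)
    (y.toHom ∘ₗ LinearMap.single A E i)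
  -- Lifts on the summands are glued; the scalars `ℕ` commute with the action of a noncommutative
  -- `A`.
  refine ⟨LinearMap.lsum A E ℕ l, ?_⟩
  change π ∘ₗ LinearMap.lsum A E ℕ l = y.toHom
  refine LinearMap.pi_ext' fun i => ?_
  rw [← hl i]
  ext x
  simp [-LinearMap.lsum_apply, LinearMap.lsum_piSingle]

theorem IsProperGprojPresentation.homFrom_exact (h : IsProperGprojPresentation θ π)
    (hE : IsGprojList A E) :
    Function.Exact (homFromMap (∀ i, E i) θ) (homFromMap (∀ i, E i) π) := by
  intro y
  constructor
  · intro hy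
    have hy' : π ∘ₗ y.toHom = 0 := hy
    choose l hl using fun i => (h.hom_exact (E i) (hE.finite i) (hE.gproj i)
      (y.toHom ∘ₗ LinearMap.single A E i)).1 (by
        change (π ∘ₗ y.toHom) ∘ₗ _ = 0
        rw [hy', LinearMap.zero_comp])
    refine ⟨LinearMap.lsum A E ℕ l, ?_⟩
    change θ ∘ₗ LinearMap.lsum A E ℕ l = y.toHom
    refine LinearMap.pi_ext' fun i => ?_
    rw [← hl i]
    ext x
    simp [-LinearMap.lsum_apply, LinearMap.lsum_piSingle]
  · rintro ⟨x, rfl⟩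
    exact LinearMap.ext fun e => h.exact.apply_apply_eq_zero (x.toHom e)

end Presentation

/-! ### Comparison of the two translates -/

section Dual

variable {k : Type v} [Field k] {A : Type u} [Ring A] [Algebra k A] {E : Type u} [AddCommGroup E]
  [Module A E] [Module k E] [IsScalarTower k A E]

variable (k) in
/-- The map of `Hom_A(G, E)` to the dual of `Hom_A(E, G)` over `End_A(E)ᵒᵖ`. -/
def homFromDual {G : Type u} [AddCommGroup G] [Module A G] :
    (G →ₗ[A] E) →ₗ[k] (HomFrom A E G →ₗ[EndOp A E] EndOp A E) where
  toFun h :=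
    { toFun := fun x => MulOpposite.op (h ∘ₗ x.toHom)
      map_add' := fun x y => congrArg MulOpposite.op (LinearMap.comp_add x.toHom y.toHom h)
      map_smul' := fun _ _ => rfl }
  map_add' h h' := LinearMap.ext fun x => congrArg MulOpposite.op (LinearMap.add_comp x.toHom h' h)
  map_smul' _ _ := rfl

/-- The regular module of `End_A(E)ᵒᵖ` is `Hom_A(E, E)`, so this is fullness on `add E`. -/
theorem homFromDual_surjective {G : Type u} [AddCommGroup G] [Module A G]
    (hG : InAdd (A := A) E G) (φ : HomFrom A E G →ₗ[EndOp A E] EndOp A E) :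
    ∃ h : G →ₗ[A] E, homFromDual k h = φ := by
  let u : EndOp A E →ₗ[EndOp A E] HomFrom A E E :=
    { toFun := fun γ => γ.unop, map_add' := fun _ _ => rfl, map_smul' := fun _ _ => rfl }
  obtain ⟨h, hh⟩ := exists_homFromMap_of_inAdd hG (u ∘ₗ φ)
  exact ⟨h, LinearMap.ext fun x => congrArg MulOpposite.op (LinearMap.congr_fun hh x)⟩

/-- The canonical map `D Hom(Hom_A(E, G), End_A(E)ᵒᵖ) ⟶ D Hom_A(G, E)`. -/
def nakayamaToDualHom {G : Type u} [AddCommGroup G] [Module A G] :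
    NakayamaDual k (EndOp A E) (HomFrom A E G) →ₗ[EndOp A E] DualHom k A E G where
  toFun φ := φ.toDual ∘ₗ homFromDual k
  map_add' _ _ := rfl
  map_smul' _ _ := rfl

/-- If there are no nonzero maps from `N` to the kernel of `D Hom_A(G₁, E) ⟶ D Hom_A(G₀, E)`, then
there are none to the kernel of the Nakayama map of `Hom_A(E, θ)`. -/
theorem hom_tau_eq_zero_of_hom_tauG {G₁ G₀ : Type u} [AddCommGroup G₁] [Module A G₁]
    [AddCommGroup G₀] [Module A G₀] (hG : InAdd (A := A) E G₁) (θ : G₁ →ₗ[A] G₀)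
    {N : Type u} [AddCommGroup N] [Module (EndOp A E) N]
    (h : ∀ g : N →ₗ[EndOp A E] tauGOfPresentation k E θ, g = 0)
    (g : N →ₗ[EndOp A E] tauOfPresentation k (homFromMap E θ)) : g = 0 := by
  let g' : N →ₗ[EndOp A E] tauGOfPresentation k E θ :=
    (nakayamaToDualHom ∘ₗ (tauOfPresentation k (homFromMap E θ)).subtype ∘ₗ g).codRestrict _
      fun x => LinearMap.ext fun y =>
        congrArg (fun ω : NakayamaDual k (EndOp A E) (HomFrom A E G₀) => ω.toDual (homFromDual k y))
          (LinearMap.mem_ker.1 (g x).2)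
  have hg' := h g'
  refine LinearMap.ext fun x => Subtype.ext (LinearMap.ext fun φ => ?_)
  obtain ⟨y, rfl⟩ := homFromDual_surjective (k := k) hG φ
  exact LinearMap.congr_fun (congrArg Subtype.val (LinearMap.congr_fun hg' x)) y

theorem endOp_finite [FiniteDimensional k A] [Module.Finite A E] :
    Module.Finite k (EndOp A E) := by
  have : Module.Finite k E := Module.Finite.trans A E
  have : Module.Finite k (Module.End A E) :=
    Module.Finite.of_injective (LinearMap.restrictScalarsₗ k A E E k)
      (LinearMap.restrictScalars_injective k)
  exact Module.Finite.equiv (MulOpposite.opLinearEquiv k)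

end Dual

/-- A map that preserves and reflects isomorphism is injective on isomorphism classes. -/
theorem FiniteIsoClasses.of_map {R S : Type u} [Ring R] [Ring S] {P : ModuleCat.{u} R → Prop}
    {Q : ModuleCat.{u} S → Prop} (hQ : FiniteIsoClasses Q) (F : ModuleCat.{u} R → ModuleCat.{u} S)
    (hF : ∀ M, P M → Q (F M))
    (hiso : ∀ M N, Nonempty (F M ≃ₗ[S] F N) ↔ Nonempty (M ≃ₗ[R] N)) : FiniteIsoClasses P := by
  have key : ∀ M N, IsIsomorphic (F M) (F N) ↔ IsIsomorphic M N := fun M N =>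
    ⟨fun ⟨i⟩ => ((hiso M N).1 ⟨i.toLinearEquiv⟩).map (·.toModuleIso),
      fun ⟨i⟩ => ((hiso M N).2 ⟨i.toLinearEquiv⟩).map (·.toModuleIso)⟩
  let f : Quotient (isIsomorphicSetoid (ModuleCat.{u} R)) →
      Quotient (isIsomorphicSetoid (ModuleCat.{u} S)) :=
    Quotient.map F fun M N h => (key M N).2 h
  refine Set.Finite.of_injOn (f := f) ?_ ?_ hQ
  · rintro _ ⟨M, hM, rfl⟩
    exact ⟨F M, hF M hM, rfl⟩
  · rintro _ ⟨M, _, rfl⟩ _ ⟨N, _, rfl⟩ h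
    exact Quotient.sound ((key M N).1 (Quotient.exact h))

end

/-! ### The finiteness theorem -/

theorem mainTheorem11 {k : Type v} [Field k] {A : Type u} [Ring A] [Algebra k A]
    [FiniteDimensional k A] {n : ℕ} (E : Fin n → Type u)
    [∀ i, AddCommGroup (E i)] [∀ i, Module A (E i)] [∀ i, Module k (E i)]
    [∀ i, IsScalarTower k A (E i)] (hE : IsGprojList A E)
    (hfin : TauTiltingFinite k (EndOp A (∀ i, E i))) :
    TauGTiltingFinite k A (∀ i, E i) ∧
      FiniteIsoClasses fun T : ModuleCat.{u} A =>
        Module.Finite A T ∧ Indecomposable T ∧ IsPartialGorensteinSilting A T := by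
  have : IsArtinianRing A := IsArtinianRing.of_finite k A
  have := hE.finite
  have : Module.Finite k (EndOp A (∀ i, E i)) := endOp_finite
  have : IsArtinianRing (EndOp A (∀ i, E i)) := IsArtinianRing.of_finite k _
  have hA : InAdd (A := A) (∀ i, E i) A := hE.inAdd A (IsGproj.of_projective A)
  let F : ModuleCat.{u} A → ModuleCat.{u} (EndOp A (∀ i, E i)) := fun M =>
    ModuleCat.of _ (HomFrom A (∀ i, E i) M)
  refine ⟨hfin.of_map F ?_ fun M N => homFrom_equiv_iff hA,
    hfin.of_map F ?_ fun M N => homFrom_equiv_iff hA⟩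
  · rintro M ⟨-, hM, G₁, G₀, θ, π, hθ, hrigid⟩
    have := hθ.finite₁
    have := hθ.finite₀
    have h₁ := hE.inAdd G₁ hθ.gproj₁
    have h₀ := hE.inAdd G₀ hθ.gproj₀
    obtain ⟨_, _⟩ := homFrom_finite_projective h₁
    obtain ⟨_, _⟩ := homFrom_finite_projective h₀
    have hs := hθ.homFrom_surjective hE
    refine ⟨Module.Finite.of_surjective _ hs, indecomposable_homFrom hA hM,
      ModuleCat.of _ (HomFrom A (∀ i, E i) G₁), ModuleCat.of _ (HomFrom A (∀ i, E i) G₀),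
      homFromMap _ θ, homFromMap _ π, ⟨‹_›, ‹_›, ‹_›, ‹_›, hθ.homFrom_exact hE, hs, ?_, ?_⟩,
      hom_tau_eq_zero_of_hom_tauG h₁ θ hrigid⟩
    · rw [isRightMinimal_rangeRestrict_iff]
      exact isRightMinimal_homFromMap h₁ hA θ ((isRightMinimal_rangeRestrict_iff θ).1 hθ.minimal₁)
    · exact isRightMinimal_homFromMap h₀ hA π hθ.minimal₀
  · rintro T ⟨-, hT, G₁, G₀, θ, π, hθ, -, hD⟩
    have := hθ.finite₁
    have := hθ.finite₀
    have h₁ := hE.inAdd G₁ hθ.gproj₁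
    obtain ⟨_, _⟩ := homFrom_finite_projective h₁
    obtain ⟨_, _⟩ := homFrom_finite_projective (hE.inAdd G₀ hθ.gproj₀)
    have hs := hθ.homFrom_surjective hE
    refine ⟨Module.Finite.of_surjective _ hs, indecomposable_homFrom hA hT,
      IsTauRigid.of_presentation k (homFromMap _ θ) (homFromMap _ π) (hθ.homFrom_exact hE) hs
        fun φ => ?_⟩
    -- Fullness turns `φ` into a map `G₁ ⟶ T`, which factors through `θ` because `T ∈ D_θ`.
    obtain ⟨h, rfl⟩ := exists_homFromMap_of_inAdd h₁ φ
    obtain ⟨h', hh'⟩ := hD h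
    exact ⟨homFromMap _ h', congrArg (homFromMap _) hh'⟩
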